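/- Call a partially ordered set $D$ a \emph{directed set} if it is nonempty and any two elements of $D$ have an upper bound in $D$. For directed sets $D,E$ write $D\leq_T E$ if there is a map $f:D\to E$ such that the image under $f$ of every subset of $D$ without an upper bound in $D$ has no upper bound in $E$; $D$ and $E$ have the same \emph{cofinal type}, $D\equiv_T E$, if $D\leq_T E$ and $E\leq_T D$. An ideal $\mathcal I$ of countable subsets of a set $X$ (a family of countable subsets of $X$ that contains all finite subsets of $X$ and is closed under subsets and finite unions) is a \emph{P-ideal} if for every sequence $(A_n)_{n\in\omega}$ in $\mathcal I$ there is $B\in\mathcal I$ such that $A_n\setminus B$ is finite for all $n$. The \emph{P-ideal dichotomy} $\mathrm{PID}$ is the statement that for every set $X$ and every P-ideal $\mathcal I$ of countable subsets of $X$, either there is an uncountable $Y\subseteq X$ all of whose countable subsets belong to $\mathcal I$, or $X=\bigcup_{n\in\omega}X_n$ for pairwise disjoint sets $X_n$ such that no countably infinite subset of any $X_n$ belongs to $\mathcal I$. Let $\mathrm{add}(\mathcal M)$ be the least cardinality of a family of meager subsets of $\mathbb R$ whose union is not meager. Assume $\mathrm{PID}$ and $\mathrm{add}(\mathcal M)>\omega_1$.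 Then $1$, $\omega$, $\omega_1$, $\omega\times\omega_1$ (with the product order) and $[\omega_1]^{<\omega}$ (the finite subsets of $\omega_1$, ordered by inclusion) are the only cofinal types of directed sets of size at most $\aleph_1$. That is, these five are directed sets of size at most $\aleph_1$, no two of them have the same cofinal type, and every directed set $D$ with $|D|\leq\aleph_1$ satisfies $D\equiv_T E$ for one of these five sets $E$. -/

import Mathlib

open Cardinal

universe u v

/-! ### Directed sets and the Tukey ordering -/

/-- A directed set: a nonempty partially ordered set in which any two elements have an upper
bound. -/
structure DirectedSet where
  /-- the underlying set -/
  carrier : Type u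
  [partialOrder : PartialOrder carrier]
  [isDirected : IsDirectedOrder carrier]
  [nonempty : Nonempty carrier]

namespace DirectedSet

instance : CoeSort DirectedSet.{u} (Type u) := ⟨DirectedSet.carrier⟩

attribute [instance] DirectedSet.partialOrder DirectedSet.isDirected DirectedSet.nonempty

/-- A map between directed sets is a Tukey map if the image of every unbounded subset is
unbounded. -/
def IsTukeyMap {D : DirectedSet.{u}} {E : DirectedSet.{v}} (f : D → E) : Prop :=
  ∀ X : Set D, ¬ BddAbove X → ¬ BddAbove (f '' X)

/-- `D` is Tukey reducible to `E`, i.e. `D ≤_T E`. -/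
def TukeyLE (D : DirectedSet.{u}) (E : DirectedSet.{v}) : Prop :=
  ∃ f : D → E, IsTukeyMap f

/-- `D` and `E` are Tukey equivalent, i.e. they have the same cofinal type. -/
def TukeyEquiv (D : DirectedSet.{u}) (E : DirectedSet.{v}) : Prop :=
  TukeyLE D E ∧ TukeyLE E D

/-- The set of all countable ordinals, with its usual well-ordering. -/
abbrev OmegaOne : Type := (Ordinal.omega.{0} 1).ToType

theorem nonempty_omegaOne : Nonempty OmegaOne :=
  Ordinal.nonempty_toType_iff.2 (Ordinal.omega_pos 1).ne'

/-- The directed sets `1`, `ω`, `ω₁`, `ω × ω₁` (with the product order) and `[ω₁]^{<ω}` (the finite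
subsets of `ω₁`, ordered by inclusion). -/
noncomputable def basicType : Fin 5 → DirectedSet.{0} :=
  haveI := nonempty_omegaOne
  ![⟨Unit⟩, ⟨ℕ⟩, ⟨OmegaOne⟩, ⟨ℕ × OmegaOne⟩, ⟨Finset OmegaOne⟩]

end DirectedSet

/-! ### The P-ideal dichotomy -/

/-- `I` is a P-ideal of countable subsets of `X`: a family of countable subsets of `X` which
contains all finite sets, is closed under subsets and finite unions, and such that every sequence of
members of `I` has a pseudo-union in `I`, i.e. a member of `I` that contains each term of the
sequence up to finitely many points. -/
structure IsPIdeal {X : Type u} (I : Set (Set X)) : Prop where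
  countable : ∀ A ∈ I, A.Countable
  finite_mem : ∀ A : Set X, A.Finite → A ∈ I
  subset_mem : ∀ A ∈ I, ∀ B ⊆ A, B ∈ I
  union_mem : ∀ A ∈ I, ∀ B ∈ I, A ∪ B ∈ I
  exists_pseudoUnion : ∀ A : ℕ → Set X, (∀ n, A n ∈ I) → ∃ B ∈ I, ∀ n, (A n \ B).Finite

/-- The P-ideal dichotomy `PID`: for every P-ideal `I` of countable subsets of a set `X`, either
there is an uncountable `Y ⊆ X` all of whose countable subsets are in `I`, or `X` is the union of
countably many pairwise disjoint sets, none of which has a countably infinite subset in `I`. -/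
def PIdealDichotomy : Prop :=
  ∀ (X : Type u) (I : Set (Set X)), IsPIdeal I →
    (∃ Y : Set X, ¬ Y.Countable ∧ ∀ A ⊆ Y, A.Countable → A ∈ I) ∨
    (∃ S : ℕ → Set X, Pairwise (fun m n => Disjoint (S m) (S n)) ∧ (⋃ n, S n) = Set.univ ∧
      ∀ n, ∀ A ⊆ S n, A.Countable → A.Infinite → A ∉ I)

/-! ### The additivity of the meager ideal -/

/-- `add(𝓜)`: the least cardinality of a family of meager subsets of `ℝ` whose union is not
meager. -/
noncomputable def addMeager : Cardinal.{0} :=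
  sInf {κ | ∃ F : Set (Set ℝ), (∀ A ∈ F, IsMeagre A) ∧ ¬ IsMeagre (⋃₀ F) ∧ #F = κ}

open Set Filter Topology PiNat

/-! ### Meagre sets of binary sequences -/

/-! Apply the dichotomy to the countable subsets of `D` meeting every `Iic d` in a finite set. They
form a P-ideal because `add(𝓜) > ω₁` makes any `ℵ₁` functions eventually dominated by one
(`exists_eventually_dominating`). In the first alternative, `D` has an uncountable subset with no
infinite bounded part, so `D` is of type `[ω₁]^{<ω}`. In the second, `D` is a countable union of
pieces `S n` in which every infinite set has an infinite bounded subset.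

The crux, `bddAbove_range_of_injective`, upgrades this: every countable subset of a piece is
bounded. If `a` enumerates an unbounded one, consider for each `n` the tree of finite index sets
bounded by an element of `S n`, with ranks modulo the ideal of index sets with bounded image. If all
roots are ranked, a diagonal sequence contradicts the property of the piece containing `a`. If some
root is unranked, a generic branch, avoiding `ℵ₁` meagre sets, lies below no single `d`, yet bounds
of its nodes chosen in `S n` produce such a `d`.

Then `D ≤_T ω × ω₁`, and the type is decided by whether all countable subsets are bounded and
whether some countable subset is cofinal. -/

theorem exists_cylinder_subset {U : Set (ℕ → Fin 2)} (hU : IsOpen U) {c : ℕ → Fin 2} (hc : c ∈ U) :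
    ∃ n, cylinder c n ⊆ U := by
  obtain ⟨_, ⟨y, n, rfl⟩, hy, hs⟩ :=
    (isTopologicalBasis_cylinders (fun _ : ℕ => Fin 2)).exists_subset_of_mem_open hc hU
  refine ⟨n, ?_⟩
  rwa [mem_cylinder_iff_eq.1 hy]

theorem isNowhereDense_compl_of_cylinder {U : Set (ℕ → Fin 2)}
    (h : ∀ c m, ∃ c' ∈ cylinder c m, ∃ N, cylinder c' N ⊆ U) : IsNowhereDense Uᶜ := by
  rw [IsNowhereDense, eq_empty_iff_forall_notMem]
  intro x hx
  obtain ⟨m, hm⟩ := exists_cylinder_subset isOpen_interior hx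
  obtain ⟨c', hc', N, hN⟩ := h x m
  have h1 : c' ∈ closure Uᶜ := interior_subset (hm hc')
  obtain ⟨y, hy, hyU⟩ := mem_closure_iff.1 h1 _ (isOpen_cylinder _ c' N) (self_mem_cylinder c' N)
  exact hyU (hN hy)

/-- Changing the digit 0 at `n` to 1 strictly increases a value that stays at most 1. -/
theorem ofDigits_lt_one {c : ℕ → Fin 2} {n : ℕ} (hn : c n = 0) : Real.ofDigits c < 1 := by
  have h := Real.ofDigits_eq_sum_add_ofDigits c (n + 1)
  set d : ℕ → Fin 2 := fun i => if i = n then 1 else c i with hd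
  have h' := Real.ofDigits_eq_sum_add_ofDigits d (n + 1)
  have e : (fun i => d (i + (n + 1))) = fun i => c (i + (n + 1)) := by
    funext i; simp only [hd]; rw [if_neg (by omega)]
  have s : ∑ i ∈ Finset.range n, Real.ofDigitsTerm d i =
      ∑ i ∈ Finset.range n, Real.ofDigitsTerm c i := by
    refine Finset.sum_congr rfl fun i hi => ?_
    have : i ≠ n := (Finset.mem_range.1 hi).ne
    simp [Real.ofDigitsTerm, hd, this]
  rw [e, Finset.sum_range_succ, s] at h'
  rw [Finset.sum_range_succ] at h
  have h0 : Real.ofDigitsTerm c n = 0 := by simp [Real.ofDigitsTerm, hn]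
  have h1 : 0 < Real.ofDigitsTerm d n := by
    simp [Real.ofDigitsTerm, hd]
  linarith [Real.ofDigits_le_one d]

theorem ofDigits_injective_at {c c' : ℕ → Fin 2} (h0 : ∀ n, ∃ i ≥ n, c i = 0)
    (h1 : ∀ n, ∃ i ≥ n, c i = 1) (h : Real.ofDigits c' = Real.ofDigits c) : c' = c := by
  by_contra hne
  set n := firstDiff c' c
  have hn : c' n ≠ c n := apply_firstDiff_ne hne
  have hs : ∑ i ∈ Finset.range n, Real.ofDigitsTerm c' i =
      ∑ i ∈ Finset.range n, Real.ofDigitsTerm c i := by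
    refine Finset.sum_congr rfl fun i hi => ?_
    have : c' i = c i := apply_eq_of_lt_firstDiff (Finset.mem_range.1 hi)
    simp [Real.ofDigitsTerm, this]
  rw [Real.ofDigits_eq_sum_add_ofDigits c' (n + 1), Real.ofDigits_eq_sum_add_ofDigits c (n + 1),
    Finset.sum_range_succ, Finset.sum_range_succ, hs] at h
  have hp : (0 : ℝ) < ((2 : ℕ) ^ (n + 1) : ℝ)⁻¹ := by positivity
  obtain ⟨i, hi, hci⟩ := h0 (n + 1)
  obtain ⟨j, hj, hcj⟩ := h1 (n + 1)
  have hlt : Real.ofDigits (fun i => c (i + (n + 1))) < 1 :=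
    ofDigits_lt_one (n := i - (n + 1)) (by simpa [Nat.sub_add_cancel hi] using hci)
  have hpos : 0 < Real.ofDigits (fun i => c (i + (n + 1))) := by
    refine Real.summable_ofDigitsTerm.tsum_pos (fun _ => Real.ofDigitsTerm_nonneg) (j - (n + 1)) ?_
    simp [Real.ofDigitsTerm, Nat.sub_add_cancel hj, hcj]
  have hle := Real.ofDigits_le_one (fun i => c' (i + (n + 1)))
  have hge := Real.ofDigits_nonneg (fun i => c' (i + (n + 1)))
  have ht : (c' n = 0 ∧ c n = 1) ∨ (c' n = 1 ∧ c n = 0) := by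
    generalize c' n = a at *
    generalize c n = b at *
    fin_cases a <;> fin_cases b <;> simp_all
  rcases ht with ⟨ha, hb⟩ | ⟨ha, hb⟩
  · simp only [Real.ofDigitsTerm, ha, hb, Fin.val_zero, Fin.val_one, Nat.cast_zero, Nat.cast_one,
      zero_mul, one_mul] at h
    nlinarith
  · simp only [Real.ofDigitsTerm, ha, hb, Fin.val_zero, Fin.val_one, Nat.cast_zero, Nat.cast_one,
      zero_mul, one_mul] at h
    nlinarith

/-- An open set inside the image would pull back to an open set not contained in the closed set `F`,
hence containing a cylinder off `F`. A point of that cylinder with alternating tail has a unique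
binary expansion, so its value cannot come from `F`. -/
theorem isNowhereDense_image_ofDigits {F : Set (ℕ → Fin 2)} (hF : IsNowhereDense F) :
    IsNowhereDense (Real.ofDigits '' F) := by
  wlog hc : IsClosed F generalizing F
  · exact (this hF.closure isClosed_closure).mono (image_mono subset_closure)
  have hK : IsClosed (Real.ofDigits '' F) :=
    (hc.isCompact.image Real.continuous_ofDigits).isClosed
  rw [hK.isNowhereDense_iff, eq_empty_iff_forall_notMem]
  intro x hx
  obtain ⟨c, -, rfl⟩ := interior_subset hx
  have ho : IsOpen (Real.ofDigits (b := 2) ⁻¹' interior (Real.ofDigits '' F)) :=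
    isOpen_interior.preimage Real.continuous_ofDigits
  obtain ⟨d, hd, hdF⟩ : ∃ d ∈ Real.ofDigits (b := 2) ⁻¹' interior (Real.ofDigits '' F), d ∉ F := by
    by_contra! hcon
    have : c ∈ interior F := mem_interior.2 ⟨_, hcon, ho, hx⟩
    rw [hc.isNowhereDense_iff.1 hF] at this
    exact this
  obtain ⟨n, hn⟩ := exists_cylinder_subset (ho.inter hc.isOpen_compl) ⟨hd, hdF⟩
  set e : ℕ → Fin 2 := fun i => if i < n then d i else if Even i then 0 else 1 with he
  have hen : e ∈ cylinder d n := mem_cylinder_iff.2 fun i hi => by simp [he, hi]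
  obtain ⟨f, hf, hfe⟩ := interior_subset (hn hen).1
  refine (hn hen).2 (ofDigits_injective_at (fun m => ?_) (fun m => ?_) hfe ▸ hf)
  · refine ⟨2 * (m + n), by omega, ?_⟩
    simp only [he]; rw [if_neg (by omega), if_pos (by simp)]
  · refine ⟨2 * (m + n) + 1, by omega, ?_⟩
    simp only [he]; rw [if_neg (by omega), if_neg (by simp)]

/-- A cylinder of length `n` is mapped onto an interval of length `2⁻ⁿ`. -/
theorem isNowhereDense_preimage_ofDigits {M : Set ℝ} (hM : IsNowhereDense M) :
    IsNowhereDense (Real.ofDigits (b := 2) ⁻¹' M) := by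
  wlog hc : IsClosed M generalizing M
  · exact (this hM.closure isClosed_closure).mono (preimage_mono subset_closure)
  rw [(hc.preimage Real.continuous_ofDigits).isNowhereDense_iff, eq_empty_iff_forall_notMem]
  intro c hx
  obtain ⟨n, hn⟩ := exists_cylinder_subset isOpen_interior hx
  set S := ∑ i ∈ Finset.range n, Real.ofDigitsTerm c i with hS
  have hp : (0 : ℝ) < ((2 : ℕ) ^ n : ℝ)⁻¹ := by positivity
  have key : Ioo S (S + ((2 : ℕ) ^ n : ℝ)⁻¹) ⊆ M := by
    intro y hy
    obtain ⟨t, -, ht⟩ := Real.ofDigits_SurjOn one_lt_two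
      (show (y - S) / ((2 : ℕ) ^ n : ℝ)⁻¹ ∈ Icc (0 : ℝ) 1 from
        ⟨div_nonneg (by linarith [hy.1]) hp.le, (div_le_one hp).2 (by linarith [hy.2])⟩)
    set e : ℕ → Fin 2 := fun i => if i < n then c i else t (i - n) with he
    have hen : e ∈ cylinder c n := mem_cylinder_iff.2 fun i hi => by simp [he, hi]
    have hm : e ∈ Real.ofDigits ⁻¹' M := interior_subset (hn hen)
    have : Real.ofDigits e ∈ M := hm
    rw [Real.ofDigits_eq_sum_add_ofDigits e n] at this
    have h1 : ∑ i ∈ Finset.range n, Real.ofDigitsTerm e i = S :=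
      Finset.sum_congr rfl fun i hi => by simp [Real.ofDigitsTerm, he, Finset.mem_range.1 hi]
    have h2 : (fun i => e (i + n)) = t := by
      funext i; simp [he]
    rw [h1, h2, ht, mul_div_cancel₀ _ hp.ne'] at this
    simpa using this
  have : S + ((2 : ℕ) ^ n : ℝ)⁻¹ / 2 ∈ interior M :=
    mem_interior.2 ⟨_, key, isOpen_Ioo, by constructor <;> linarith⟩
  rw [hc.isNowhereDense_iff.1 hM] at this
  exact this

theorem isMeagre_of_maps_isNowhereDense {X Y : Type*} [TopologicalSpace X] [TopologicalSpace Y]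
    (g : Set X → Set Y) (hg : ∀ F, IsNowhereDense F → IsNowhereDense (g F))
    (hmono : ∀ (S : Set (Set X)) A, A ⊆ ⋃₀ S → g A ⊆ ⋃₀ (g '' S)) {A : Set X} (hA : IsMeagre A) :
    IsMeagre (g A) := by
  rw [isMeagre_iff_countable_union_isNowhereDense] at hA ⊢
  obtain ⟨S, hS, hc, hA⟩ := hA
  exact ⟨g '' S, by rintro _ ⟨F, hF, rfl⟩; exact hg F (hS F hF), hc.image g, hmono S A hA⟩

theorem isMeagre_iUnion_of_mk_le (hadd : ℵ₁ < addMeager) {ι : Type u} (hι : #ι ≤ ℵ₁)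
    {A : ι → Set (ℕ → Fin 2)} (hA : ∀ i, IsMeagre (A i)) : IsMeagre (⋃ i, A i) := by
  have himg : ∀ i, IsMeagre (Real.ofDigits '' A i) := fun i =>
    isMeagre_of_maps_isNowhereDense (image Real.ofDigits)
      (fun F hF => isNowhereDense_image_ofDigits hF)
      (fun S A h => by
        rintro _ ⟨c, hc, rfl⟩
        obtain ⟨F, hF, hcF⟩ := h hc
        exact ⟨_, ⟨F, hF, rfl⟩, c, hcF, rfl⟩) (hA i)
  have hU : IsMeagre (⋃₀ range fun i => Real.ofDigits '' A i) := by
    by_contra hcon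
    refine absurd hadd (not_lt.2 ?_)
    have h1 : addMeager ≤ #(range fun i => Real.ofDigits '' A i) :=
      csInf_le' ⟨_, by rintro _ ⟨i, rfl⟩; exact himg i, hcon, rfl⟩
    refine h1.trans ?_
    have h2 := mk_range_le_lift (f := fun i => Real.ofDigits '' A i)
    have h3 : lift.{0} #ι ≤ ℵ₁ := by simpa using hι
    simpa using h2.trans h3
  have := isMeagre_of_maps_isNowhereDense (preimage (Real.ofDigits (b := 2)))
      (fun F hF => isNowhereDense_preimage_ofDigits hF)
      (fun S A h => by
        intro c hc
        obtain ⟨F, hF, hcF⟩ := h hc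
        exact ⟨_, ⟨F, hF, rfl⟩, hcF⟩) hU
  refine this.mono ?_
  rintro c hc
  obtain ⟨i, hi⟩ := mem_iUnion.1 hc
  exact ⟨_, ⟨i, rfl⟩, c, hi, rfl⟩

/-! ### Dominating families of `ℵ₁` functions -/

theorem isMeagre_setOf_not_frequently_zero_run (f : ℕ → ℕ) :
    IsMeagre {c : ℕ → Fin 2 | ¬ ∀ m, ∃ n ≥ m, ∀ i, n ≤ i → i < f n → c i = 0} := by
  have : {c : ℕ → Fin 2 | ¬ ∀ m, ∃ n ≥ m, ∀ i, n ≤ i → i < f n → c i = 0} =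
      ⋃ m, {c : ℕ → Fin 2 | ∃ n ≥ m, ∀ i, n ≤ i → i < f n → c i = 0}ᶜ := by
    ext c; simp
  rw [this]
  refine isMeagre_iUnion fun m => (isNowhereDense_compl_of_cylinder fun c k => ?_).isMeagre
  refine ⟨fun i => if i < k then c i else 0, mem_cylinder_iff.2 fun i hi => if_pos hi,
    f (max m k), fun d hd => ⟨max m k, le_max_left _ _, fun i hi hif => ?_⟩⟩
  rw [mem_cylinder_iff.1 hd i hif, if_neg (by have := le_max_right m k; omega)]

theorem IsMeagre.exists_antitone_dense {X : Type*} [TopologicalSpace X] [BaireSpace X] {M : Set X}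
    (hM : IsMeagre M) : ∃ V : ℕ → Set X, (∀ k, IsOpen (V k)) ∧ (∀ k, Dense (V k)) ∧ Antitone V ∧
      ⋂ k, V k ⊆ Mᶜ := by
  obtain ⟨S, ho, hd, hc, hS⟩ := mem_residual_iff.1 hM
  obtain ⟨W, hW⟩ := (hc.insert Set.univ).exists_eq_range (insert_nonempty _ _)
  have hWo : ∀ i, IsOpen (W i) := fun i => by
    have : W i ∈ insert Set.univ S := hW ▸ mem_range_self i
    rcases this with h | h
    · rw [h]; exact isOpen_univ
    · exact ho _ h
  have hWd : ∀ i, Dense (W i) := fun i => by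
    have : W i ∈ insert Set.univ S := hW ▸ mem_range_self i
    rcases this with h | h
    · rw [h]; exact dense_univ
    · exact hd _ h
  refine ⟨fun k => ⋂ i ∈ Finset.range (k + 1), W i, fun k => isOpen_biInter_finset fun i _ => hWo i,
    fun k => dense_of_mem_residual ?_, fun k l hkl => ?_, fun x hx => hS fun s hs => ?_⟩
  · exact (Filter.biInter_finset_mem _).2 fun i _ => residual_of_dense_open (hWo i) (hWd i)
  · exact biInter_subset_biInter_left fun i hi =>
      Finset.mem_range.2 ((Finset.mem_range.1 hi).trans_le (by omega))
  · have : s ∈ insert Set.univ S := Or.inr hs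
    rw [hW] at this
    obtain ⟨i, rfl⟩ := this
    exact mem_iInter₂.1 (mem_iInter.1 hx i) i (Finset.mem_range.2 (Nat.lt_succ_self i))

/-- Only finitely many initial segments of length `n` exist, so one `M` serves them all. The final
digit 1 is there to break zero runs. -/
theorem exists_uniform_extension {V : Set (ℕ → Fin 2)} (ho : IsOpen V) (hd : Dense V) (n : ℕ) :
    ∃ M ≥ n, ∀ c, ∃ c' ∈ cylinder c n, c' M = 1 ∧ cylinder c' (M + 1) ⊆ V := by
  have h : ∀ c, ∃ c' ∈ cylinder c n, ∃ N, cylinder c' N ⊆ V := fun c => by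
    obtain ⟨c', hc, hV⟩ := hd.inter_open_nonempty _ (isOpen_cylinder _ c n) ⟨c, self_mem_cylinder c n⟩
    exact ⟨c', hc, exists_cylinder_subset ho hV⟩
  choose e he N hN using h
  let r : (Fin n → Fin 2) → ℕ → Fin 2 := fun s i => if hi : i < n then s ⟨i, hi⟩ else 0
  let M := n + Finset.univ.sup fun s => N (r s)
  refine ⟨M, Nat.le_add_right _ _, fun c => ?_⟩
  let s : Fin n → Fin 2 := fun i => c i
  have hs : N (r s) ≤ M :=
    (Finset.le_sup (f := fun s => N (r s)) (Finset.mem_univ s)).trans (Nat.le_add_left _ _)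
  refine ⟨fun i => if i < M then e (r s) i else 1, mem_cylinder_iff.2 fun i hi => ?_, by simp,
    fun d hd => hN (r s) (mem_cylinder_iff.2 fun i hi => ?_)⟩
  · have hiM : i < M := hi.trans_le (Nat.le_add_right _ _)
    rw [if_pos hiM, mem_cylinder_iff.1 (he (r s)) i hi]
    simp [r, s, hi]
  · rw [mem_cylinder_iff.1 hd i (by omega), if_pos (by omega)]

/-- This is the core of `add(𝓜) ≤ 𝔟`. Choose `N` so that every segment of length `N k` extends into
`V k` before `N (k + 1)`. If `f (N k)` exceeds `N (k + 1)` infinitely often, those blocks suffice to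
enter all `V k`, while digits 1 elsewhere and at the block ends destroy every zero run. -/
theorem exists_eventually_le_of_zero_runs {V : ℕ → Set (ℕ → Fin 2)} (ho : ∀ k, IsOpen (V k))
    (hd : ∀ k, Dense (V k)) (hV : Antitone V) :
    ∃ g : ℕ → ℕ, ∀ f : ℕ → ℕ, Monotone f → (∀ n, n < f n) →
      (∀ c ∈ ⋂ k, V k, ∀ m, ∃ n ≥ m, ∀ i, n ≤ i → i < f n → c i = 0) →
      ∀ᶠ n in atTop, f n ≤ g n := by
  choose M hM e he he1 heV using fun k n => exists_uniform_extension (ho k) (hd k) n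
  let N : ℕ → ℕ := fun k => Nat.rec 0 (fun k n => M k n + 1) k
  have hN : ∀ k, N (k + 1) = M k (N k) + 1 := fun _ => rfl
  have hNm : StrictMono N := strictMono_nat_of_lt_succ fun k => by
    rw [hN]; exact Nat.lt_succ_of_le (hM k (N k))
  refine ⟨fun k => N (k + 1), fun f hf hfn hG => ?_⟩
  by_contra hcon
  rw [not_eventually] at hcon
  have hK : ∃ᶠ k in atTop, N (k + 1) < f (N k) :=
    hcon.mono fun k hk => (not_le.1 hk).trans_le (hf (hNm.le_apply))
  classical
  let C : ℕ → ℕ → Fin 2 := fun k => Nat.rec (fun _ => 1) (fun k c =>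
    if N (k + 1) < f (N k) then fun i => if i < N (k + 1) then e k (N k) c i else 1 else c) k
  have hC : ∀ k, C (k + 1) = if N (k + 1) < f (N k) then
    fun i => if i < N (k + 1) then e k (N k) (C k) i else 1 else C k := fun _ => rfl
  have hC1 : ∀ k i, N k ≤ i → C k i = 1 := by
    intro k
    induction k with
    | zero => intro i _; rfl
    | succ k ih =>
      intro i hi
      rw [hC]
      split_ifs with h
      · simp [not_lt.2 hi]
      · exact ih i ((hNm (Nat.lt_succ_self k)).le.trans hi)
  have hCs : ∀ k i, i < N k → C (k + 1) i = C k i := by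
    intro k i hi
    rw [hC]
    split_ifs with h
    · simp only [hi.trans (hNm (Nat.lt_succ_self k)), if_true]
      exact mem_cylinder_iff.1 (he k (N k) (C k)) i hi
    · rfl
  have hCm : ∀ k j i, k ≤ j → i < N k → C j i = C k i := by
    intro k j i hkj hi
    induction j, hkj using Nat.le_induction with
    | base => rfl
    | succ j hj ih => rw [hCs j i (hi.trans_le (hNm.monotone hj)), ih]
  let c : ℕ → Fin 2 := fun i => C (i + 1) i
  have hc : ∀ k i, i < N k → c i = C k i := by
    intro k i hi
    rcases le_total k (i + 1) with h | h
    · exact hCm k (i + 1) i h hi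
    · exact (hCm (i + 1) k i h ((Nat.lt_succ_self i).trans_le hNm.le_apply)).symm
  have hcV : c ∈ ⋂ k, V k := by
    refine mem_iInter.2 fun k => ?_
    obtain ⟨l, hkl, hl⟩ := (frequently_atTop.1 hK) k
    refine hV hkl (heV l (N l) (C l) (mem_cylinder_iff.2 fun i hi => ?_))
    rw [hc (l + 1) i hi, hC, if_pos hl]
    exact if_pos hi
  obtain ⟨n, -, hn⟩ := hG c hcV 0
  obtain ⟨k, hk1, hk2⟩ : ∃ k, N k ≤ n ∧ n < N (k + 1) := by
    have hex : ∃ k, n < N (k + 1) := ⟨n, (Nat.lt_succ_self n).trans_le hNm.le_apply⟩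
    refine ⟨Nat.find hex, ?_, Nat.find_spec hex⟩
    rcases h : Nat.find hex with _ | k
    · exact Nat.zero_le _
    · exact not_lt.1 (Nat.find_min hex (h ▸ Nat.lt_succ_self k))
  by_cases hk : N (k + 1) < f (N k)
  · have h0 := hn (M k (N k)) (by rw [hN] at hk2; omega) (by
      have := hf hk1
      rw [hN] at hk; omega)
    rw [hc (k + 1) _ (by rw [hN]; omega), hC, if_pos hk] at h0
    simp only [hN, Nat.lt_succ_self, if_true, he1] at h0
    exact one_ne_zero h0
  · have h0 := hn n le_rfl (hfn n)
    rw [hc (k + 1) n hk2, hC, if_neg hk, hC1 k n hk1] at h0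
    exact one_ne_zero h0

theorem exists_eventually_dominating (hadd : ℵ₁ < addMeager) {ι : Type u} (hι : #ι ≤ ℵ₁)
    (F : ι → ℕ → ℕ) : ∃ g : ℕ → ℕ, ∀ i, ∀ᶠ n in atTop, F i n ≤ g n := by
  -- A monotone majorant of `F i` lying strictly above the identity.
  let F' : ι → ℕ → ℕ := fun i n => n + 1 + ∑ j ∈ Finset.range (n + 1), F i j
  obtain ⟨V, ho, hd, hV, hVM⟩ := (isMeagre_iUnion_of_mk_le hadd hι
    fun i => isMeagre_setOf_not_frequently_zero_run (F' i)).exists_antitone_dense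
  obtain ⟨g, hg⟩ := exists_eventually_le_of_zero_runs ho hd hV
  refine ⟨g, fun i => (hg (F' i) (fun m n hmn => ?_) (fun n => ?_) fun c hc => ?_).mono fun n hn => ?_⟩
  · have : ∑ j ∈ Finset.range (m + 1), F i j ≤ ∑ j ∈ Finset.range (n + 1), F i j :=
      Finset.sum_le_sum_of_subset (Finset.range_mono (by omega))
    simp only [F']; omega
  · simp only [F']; omega
  · by_contra hcon
    exact hVM hc (mem_iUnion.2 ⟨i, hcon⟩)
  · have : F i n ≤ ∑ j ∈ Finset.range (n + 1), F i j :=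
      Finset.single_le_sum (f := F i) (fun _ _ => Nat.zero_le _)
        (Finset.mem_range.2 (Nat.lt_succ_self n))
    simp only [F'] at hn; omega

/-! ### Generic paths through trees of finite sets -/

open Classical in
/-- The finite subset of `ℕ` which the binary sequence `c` selects below a given number, never
leaving the family `U`. -/
noncomputable def genericPath (U : Set (Finset ℕ)) (c : ℕ → Fin 2) : ℕ → Finset ℕ
  | 0 => ∅
  | n + 1 => if c n = 1 ∧ insert n (genericPath U c n) ∈ U then insert n (genericPath U c n)
      else genericPath U c n

theorem genericPath_mem {U : Set (Finset ℕ)} (h0 : ∅ ∈ U) (c : ℕ → Fin 2) (n : ℕ) :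
    genericPath U c n ∈ U := by
  induction n with
  | zero => exact h0
  | succ n ih =>
    rw [genericPath]
    split_ifs with h
    · exact h.2
    · exact ih

theorem genericPath_monotone (U : Set (Finset ℕ)) (c : ℕ → Fin 2) : Monotone (genericPath U c) := by
  refine monotone_nat_of_le_succ fun n => ?_
  conv_rhs => rw [genericPath]
  split_ifs
  · exact Finset.subset_insert _ _
  · exact le_rfl

theorem genericPath_congr (U : Set (Finset ℕ)) {c d : ℕ → Fin 2} {n : ℕ} (h : ∀ i < n, d i = c i) :
    genericPath U d n = genericPath U c n := by
  induction n with
  | zero => rfl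
  | succ n ih =>
    rw [genericPath, genericPath, ih fun i hi => h i (by omega), h n (by omega)]

theorem genericPath_eq_of_zero (U : Set (Finset ℕ)) {c : ℕ → Fin 2} {m k : ℕ} (hmk : m ≤ k)
    (h : ∀ i, m ≤ i → i < k → c i = 0) : genericPath U c k = genericPath U c m := by
  induction k, hmk using Nat.le_induction with
  | base => rfl
  | succ k hk ih =>
    rw [genericPath, if_neg (by simp [h k hk (Nat.lt_succ_self k)]),
      ih fun i hi hik => h i hi (by omega)]

/-- For each `i`, the sequences whose path stays inside `X i` form a nowhere dense set: pad with
zeros, which freeze the path, up to an admissible `k ∉ X i`, then select `k`. So `ℵ₁` many such sets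
do not cover the space. -/
theorem exists_path_not_subset (hadd : ℵ₁ < addMeager) {ι : Type u} (hι : #ι ≤ ℵ₁)
    (X : ι → Set ℕ) {U : Set (Finset ℕ)} (h0 : ∅ ∈ U)
    (hU : ∀ i, ∀ s ∈ U, ∀ m, ∃ k ≥ m, insert k s ∈ U ∧ k ∉ X i) :
    ∃ p : ℕ → Finset ℕ, Monotone p ∧ (∀ n, p n ∈ U) ∧ ∀ i, ∃ n, ∃ k ∈ p n, k ∉ X i := by
  have hm := isMeagre_iUnion_of_mk_le hadd hι
    (A := fun i => {c | ∃ n, ∃ k ∈ genericPath U c n, k ∉ X i}ᶜ) fun i => by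
      refine (isNowhereDense_compl_of_cylinder fun c m => ?_).isMeagre
      obtain ⟨k, hk, hkU, hkX⟩ := hU i _ (genericPath_mem h0 c m) m
      let c' : ℕ → Fin 2 := fun j => if j < m then c j else if j < k then 0 else 1
      refine ⟨c', mem_cylinder_iff.2 fun j hj => if_pos hj, k + 1, fun d hd =>
        ⟨k + 1, k, ?_, hkX⟩⟩
      have e : genericPath U c' k = genericPath U c m := by
        rw [genericPath_eq_of_zero U hk fun j hj hjk => by simp [c', not_lt.2 hj, hjk],
          genericPath_congr U (c := c) fun j hj => by simp [c', hj]]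
      rw [genericPath_congr U (mem_cylinder_iff.1 hd), genericPath, e,
        if_pos ⟨by simp [c', not_lt.2 hk], hkU⟩]
      exact Finset.mem_insert_self _ _
  have : ∃ c, c ∉ ⋃ i, {c | ∃ n, ∃ k ∈ genericPath U c n, k ∉ X i}ᶜ := by
    by_contra! hcon
    exact not_isMeagre_of_isOpen isOpen_univ univ_nonempty (hm.mono fun c _ => hcon c)
  obtain ⟨c, hc⟩ := this
  refine ⟨genericPath U c, genericPath_monotone U c, genericPath_mem h0 c, fun i => ?_⟩
  by_contra hcon
  exact hc (mem_iUnion.2 ⟨i, hcon⟩)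

/-! ### Ranks of finite sets modulo an ideal -/

/-- `s` has rank at most `α` in the tree `T`, where one-point extensions by a set of points in `J`
are disregarded. -/
inductive HasRankLE (J : Set (Set ℕ)) (T : Set (Finset ℕ)) : Ordinal.{0} → Finset ℕ → Prop
  | intro {α : Ordinal.{0}} {s : Finset ℕ} (b : Set ℕ) (hb : b ∈ J) (β : ℕ → Ordinal.{0})
      (hβ : ∀ k, k ∉ b → insert k s ∈ T → β k < α)
      (h : ∀ k, k ∉ b → insert k s ∈ T → HasRankLE J T (β k) (insert k s)) : HasRankLE J T α s

/-- Otherwise this set could be discarded, and the successor of the supremum of the remaining ranks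
would rank `s`. -/
theorem setOf_unranked_notMem {J : Set (Set ℕ)} {T : Set (Finset ℕ)} {s : Finset ℕ}
    (hs : ∀ α, ¬ HasRankLE J T α s) :
    {k | insert k s ∈ T ∧ ∀ α, ¬ HasRankLE J T α (insert k s)} ∉ J := by
  classical
  intro hb
  let β : ℕ → Ordinal.{0} := fun k =>
    if h : ∃ α, HasRankLE J T α (insert k s) then h.choose else 0
  refine hs (Order.succ (⨆ k, β k)) (.intro _ hb β
    (fun k _ _ => Order.lt_succ_iff.2 (Ordinal.le_iSup β k)) fun k hk hkT => ?_)
  have h : ∃ α, HasRankLE J T α (insert k s) := by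
    by_contra! hcon
    exact hk ⟨hkT, hcon⟩
  simp only [β, dif_pos h]
  exact h.choose_spec

theorem exists_small_set_of_ranked {J : Set (Set ℕ)} {T : Set (Finset ℕ)} (hJ : ∅ ∈ J) :
    ∃ (r : Finset ℕ → Ordinal.{0}) (b : Finset ℕ → Set ℕ), (∀ s, b s ∈ J) ∧
      ∀ s, (∃ α, HasRankLE J T α s) → ∀ k ∉ b s, insert k s ∈ T →
        (∃ α, HasRankLE J T α (insert k s)) ∧ r (insert k s) < r s := by
  refine ⟨fun s => sInf {α | HasRankLE J T α s}, ?_⟩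
  have : ∀ s, ∃ b ∈ J, (∃ α, HasRankLE J T α s) → ∀ k ∉ b, insert k s ∈ T →
        (∃ α, HasRankLE J T α (insert k s)) ∧
          sInf {α | HasRankLE J T α (insert k s)} < sInf {α | HasRankLE J T α s} := by
    intro s
    by_cases hs : ∃ α, HasRankLE J T α s
    · have hm : HasRankLE J T (sInf {α | HasRankLE J T α s}) s := csInf_mem hs
      obtain ⟨α, hα⟩ : ∃ α, sInf {α | HasRankLE J T α s} = α := ⟨_, rfl⟩
      rw [hα] at hm ⊢
      obtain ⟨b, hb, β, hβ, h⟩ := hm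
      exact ⟨b, hb, fun _ k hk hkT => ⟨⟨_, h k hk hkT⟩, 
        (csInf_le' (s := {α | HasRankLE J T α (insert k s)}) (h k hk hkT)).trans_lt (hβ k hk hkT)⟩⟩
    · exact ⟨∅, hJ, fun h => absurd h hs⟩
  choose b hb h using this
  exact ⟨b, hb, h⟩

/-- Choose `P` diagonally, each new point avoiding the exceptional sets of all earlier nodes in the
first few trees. -/
theorem exists_infinite_of_ranked {J : Set (Set ℕ)} (hfin : ∀ X : Set ℕ, X.Finite → X ∈ J)
    (hunion : ∀ X ∈ J, ∀ Y ∈ J, X ∪ Y ∈ J) (huniv : Set.univ ∉ J) {T : ℕ → Set (Finset ℕ)}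
    (hT : ∀ n, ∃ α, HasRankLE J (T n) α ∅) :
    ∃ P : Set ℕ, P.Infinite ∧ ∀ n, ∀ Z ⊆ P, Z.Infinite → ∃ s : Finset ℕ, ↑s ⊆ Z ∧ s ∉ T n := by
  have hbU : ∀ {κ : Type} (F : Finset κ) (b : κ → Set ℕ), (∀ i, b i ∈ J) → ⋃ i ∈ F, b i ∈ J := by
    classical
    intro κ F b hb
    induction F using Finset.induction_on with
    | empty => simpa using hfin ∅ finite_empty
    | insert i F _ ih => rw [Finset.set_biUnion_insert]; exact hunion _ (hb i) _ ih
  choose r b hbJ hb using fun n => exists_small_set_of_ranked (T := T n) (hfin ∅ finite_empty)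
  have hq : ∀ m : ℕ, ∃ q ≥ m, ∀ n < m, ∀ s ⊆ Finset.range m, q ∉ b n s := by
    intro m
    have hB : (⋃ n ∈ Finset.range m, ⋃ s ∈ (Finset.range m).powerset, b n s) ∪ Iio m ∈ J :=
      hunion _ (hbU _ _ fun n => hbU _ _ (hbJ n)) _ (hfin _ (finite_Iio m))
    obtain ⟨q, hq⟩ : ∃ q, q ∉ (⋃ n ∈ Finset.range m, ⋃ s ∈ (Finset.range m).powerset, b n s) ∪ Iio m := by
      by_contra! hcon
      exact huniv (eq_univ_of_forall hcon ▸ hB)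
    refine ⟨q, not_lt.1 fun h => hq (Or.inr h), fun n hn s hs hqs => hq (Or.inl ?_)⟩
    exact mem_iUnion₂.2 ⟨n, Finset.mem_range.2 hn, mem_iUnion₂.2 ⟨s, Finset.mem_powerset.2 hs, hqs⟩⟩
  choose q hqm hqb using hq
  let p : ℕ → ℕ := fun i => Nat.rec (q 0) (fun _ x => q (x + 1)) i
  have hp : ∀ i, p (i + 1) = q (p i + 1) := fun _ => rfl
  have hpm : StrictMono p := strictMono_nat_of_lt_succ fun i => by
    rw [hp]; exact Nat.lt_of_succ_le (hqm _)
  have hP : ∀ i j, i < j → ∀ n ≤ p i, ∀ s ⊆ Finset.range (p i + 1), p j ∉ b n s := by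
    intro i j hij n hn s hs
    obtain ⟨j, rfl⟩ : ∃ l, j = l + 1 := ⟨j - 1, by omega⟩
    have : p i ≤ p j := hpm.monotone (by omega)
    exact hqb (p j + 1) n (by omega) s (hs.trans (Finset.range_mono (by omega)))
  refine ⟨range p, infinite_range_of_injective hpm.injective, fun n Z hZP hZ => ?_⟩
  by_contra! hcon
  -- If all finite subsets of `Z` were in `T n`, adding points of `Z` one at a time would make the
  -- ranks descend forever.
  have key : ∀ α : Ordinal.{0}, ∀ s : Finset ℕ, r n s = α → ↑s ⊆ Z →
      (∃ α, HasRankLE J (T n) α s) → ∀ i, n ≤ p i → s ⊆ Finset.range (p i + 1) → False := by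
    intro α
    induction α using WellFoundedLT.induction with
    | ind α ih =>
      intro s hα hsZ hs i hi hsi
      obtain ⟨y, hyZ, hy⟩ := hZ.exists_gt (p i)
      obtain ⟨j, rfl⟩ := hZP hyZ
      have hins : ↑(insert (p j) s) ⊆ Z := by
        rw [Finset.coe_insert]; exact insert_subset hyZ hsZ
      obtain ⟨h1, h2⟩ := hb n s hs (p j) (hP i j (hpm.lt_iff_lt.1 hy) n hi s hsi) (hcon _ hins)
      refine ih _ (hα ▸ h2) _ rfl hins h1 j (by omega) ?_
      refine Finset.insert_subset (Finset.mem_range.2 (Nat.lt_succ_self _)) (hsi.trans ?_)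
      exact Finset.range_mono (by omega)
  exact key _ ∅ rfl (by simp) (hT n) n hpm.le_apply (by simp)

theorem exists_countable_infinite_subset {α : Type u} {A : Set α} (hA : A.Infinite) :
    ∃ B ⊆ A, B.Infinite ∧ B.Countable :=
  ⟨range fun n => (hA.natEmbedding A n : α), range_subset_iff.2 fun n => (hA.natEmbedding A n).2,
    infinite_range_of_injective (Subtype.val_injective.comp (hA.natEmbedding A).injective),
    countable_range _⟩

namespace DirectedSet

/-! ### Consequences of the dichotomy -/

/-- The family of countable subsets of `D` having finite intersection with every bounded set. -/
def orthogonalIdeal (D : DirectedSet.{u}) : Set (Set D) :=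
  {A | A.Countable ∧ ∀ d, (A ∩ Iic d).Finite}

theorem isPIdeal_orthogonalIdeal (hadd : ℵ₁ < addMeager) {D : DirectedSet.{u}} (hD : #D ≤ ℵ₁) :
    IsPIdeal D.orthogonalIdeal where
  countable A hA := hA.1
  finite_mem A hA := ⟨hA.countable, fun d => hA.subset inter_subset_left⟩
  subset_mem A hA B hB :=
    ⟨hA.1.mono hB, fun d => (hA.2 d).subset (inter_subset_inter_left _ hB)⟩
  union_mem A hA B hB := ⟨hA.1.union hB.1, fun d => by
    rw [union_inter_distrib_right]; exact (hA.2 d).union (hB.2 d)⟩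
  exists_pseudoUnion A hA := by
    have he : ∀ n, ∃ e : D → ℕ, InjOn e (A n) := fun n => countable_iff_exists_injOn.1 (hA n).1
    choose e he using he
    have hF : ∀ (d : D) n, ∃ m, ∀ a ∈ A n, a ≤ d → e n a ≤ m := fun d n => by
      obtain ⟨m, hm⟩ := (((hA n).2 d).image (e n)).bddAbove
      exact ⟨m, fun a ha had => hm ⟨a, ⟨ha, had⟩, rfl⟩⟩
    choose F hF using hF
    obtain ⟨g, hg⟩ := exists_eventually_dominating hadd hD F
    -- Removing from `A n` the points with code at most `g n` costs finitely many, and leaves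
    -- nothing below `d` once `F d n ≤ g n`.
    refine ⟨⋃ n, {a ∈ A n | g n < e n a}, ⟨countable_iUnion fun n => (hA n).1.mono (sep_subset _ _),
      fun d => ?_⟩, fun n => ?_⟩
    · obtain ⟨N, hN⟩ := eventually_atTop.1 (hg d)
      refine ((finite_lt_nat N).biUnion fun n _ => (hA n).2 d).subset ?_
      rintro a ⟨ha, had⟩
      obtain ⟨n, hna, hgn⟩ := mem_iUnion.1 ha
      refine mem_iUnion₂.2 ⟨n, show n < N from not_le.1 fun hn => ?_, hna, had⟩
      exact absurd (hgn.trans_le ((hF d n a hna had).trans (hN n hn))) (lt_irrefl _)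
    · refine Finite.of_finite_image ((finite_Iic (g n)).subset ?_)
        ((he n).mono (sdiff_subset (t := ⋃ n, {a ∈ A n | g n < e n a})))
      rintro _ ⟨a, ⟨ha, hna⟩, rfl⟩
      by_contra hcon
      exact hna (mem_iUnion.2 ⟨n, ha, not_le.1 hcon⟩)

theorem exists_infinite_setOf_le {D : DirectedSet.{u}} {S : Set D}
    (hS : ∀ A ⊆ S, A.Infinite → ∃ d, (A ∩ Iic d).Infinite) (x : ℕ → D) (hx : ∀ n, x n ∈ S) :
    ∃ d, {n | x n ≤ d}.Infinite := by
  by_cases hr : (range x).Finite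
  · have : Finite (range x) := hr
    obtain ⟨⟨d, _⟩, hd⟩ := Finite.exists_infinite_fiber (rangeFactorization x)
    refine ⟨d, (infinite_coe_iff.1 hd).mono fun n hn => ?_⟩
    exact (congrArg Subtype.val hn).le
  · obtain ⟨d, hd⟩ := hS (range x) (range_subset_iff.2 hx) hr
    refine ⟨d, fun hfin => hd ((hfin.image x).subset ?_)⟩
    rintro _ ⟨⟨n, rfl⟩, hn⟩
    exact ⟨n, hn, rfl⟩

theorem bddAbove_range_of_injective (hadd : ℵ₁ < addMeager) {D : DirectedSet.{u}} (hD : #D ≤ ℵ₁)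
    {S : ℕ → Set D} (hS : ⋃ n, S n = Set.univ)
    (htall : ∀ n, ∀ A ⊆ S n, A.Infinite → ∃ d, (A ∩ Iic d).Infinite) {k : ℕ} {a : ℕ → D}
    (ha : Function.Injective a) (hak : ∀ i, a i ∈ S k) : BddAbove (range a) := by
  by_contra hunb
  let J : Set (Set ℕ) := {X | BddAbove (a '' X)}
  let T : ℕ → Set (Finset ℕ) := fun n => {s | ∃ d ∈ S n, ∀ i ∈ s, a i ≤ d}
  by_cases hT : ∀ n, ∃ α, HasRankLE J (T n) α ∅
  · obtain ⟨P, hP, hPT⟩ := exists_infinite_of_ranked (J := J) (fun X hX => (hX.image a).bddAbove)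
      (fun X hX Y hY => by
        change BddAbove (a '' (X ∪ Y)); rw [image_union]; exact BddAbove.union hX hY)
      (fun h => hunb (image_univ (f := a) ▸ h)) hT
    obtain ⟨d, hd⟩ := htall k (a '' P) (by rintro _ ⟨i, -, rfl⟩; exact hak i)
      (hP.image ha.injOn)
    obtain ⟨n, hn⟩ := mem_iUnion.1 (hS ▸ mem_univ d)
    obtain ⟨s, hs, hsT⟩ := hPT n {i ∈ P | a i ≤ d} (sep_subset _ _) fun hfin =>
      hd ((hfin.image a).subset (by rintro _ ⟨⟨i, hi, rfl⟩, hid⟩; exact ⟨i, ⟨hi, hid⟩, rfl⟩))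
    exact hsT ⟨d, hn, fun i hi => (hs hi).2⟩
  -- The nodes of the generic branch increase, so a `d` above infinitely many of the bounds `x i` is
  -- above the whole branch.
  · push Not at hT
    obtain ⟨n, hn⟩ := hT
    have hpos : ∀ s, (∀ α, ¬ HasRankLE J (T n) α s) → ∀ d : D, ∀ m, ∃ k ≥ m,
        (insert k s ∈ T n ∧ ∀ α, ¬ HasRankLE J (T n) α (insert k s)) ∧ k ∉ {i | a i ≤ d} := by
      intro s hs d m
      by_contra! hcon
      refine setOf_unranked_notMem hs (BddAbove.mono ?_
        ((bddAbove_Iic (a := d)).union ((finite_Iio m).image a).bddAbove))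
      rintro _ ⟨i, hi, rfl⟩
      by_cases him : i < m
      · exact Or.inr ⟨i, him, rfl⟩
      · exact Or.inl (hcon i (not_lt.1 him) hi)
    have h0 : ∅ ∈ T n := by
      obtain ⟨k, -, ⟨⟨d, hd, -⟩, -⟩, -⟩ := hpos ∅ hn (a 0) 0
      exact ⟨d, hd, by simp⟩
    obtain ⟨p, hpm, hpU, hp⟩ := exists_path_not_subset hadd hD (fun d : D => {i | a i ≤ d})
      (U := {s | s ∈ T n ∧ ∀ α, ¬ HasRankLE J (T n) α s}) ⟨h0, hn⟩
      (fun d s hs m => hpos s hs.2 d m)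
    choose x hxS hx using fun i => (hpU i).1
    obtain ⟨d, hd⟩ := exists_infinite_setOf_le (htall n) x hxS
    obtain ⟨i, k, hk, hkd⟩ := hp d
    obtain ⟨j, hj, hij⟩ := hd.exists_gt i
    exact hkd ((hx j k (hpm hij.le hk)).trans hj)

/-- The effect of the dichotomy on a directed set of size at most `ℵ₁`. -/
theorem exists_uncountable_or_cover (hPID : PIdealDichotomy.{u}) (hadd : ℵ₁ < addMeager)
    {D : DirectedSet.{u}} (hD : #D ≤ ℵ₁) :
    (∃ Y : Set D, ¬ Y.Countable ∧ ∀ A ⊆ Y, A.Infinite → ¬ BddAbove A) ∨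
    (∃ S : ℕ → Set D, ⋃ n, S n = Set.univ ∧ ∀ n, ∀ A ⊆ S n, A.Countable → BddAbove A) := by
  rcases hPID D _ (isPIdeal_orthogonalIdeal hadd hD) with ⟨Y, hY, hYI⟩ | ⟨S, -, hS, hSI⟩
  · refine Or.inl ⟨Y, hY, fun A hA hinf ⟨d, hd⟩ => ?_⟩
    obtain ⟨B, hBA, hB, hBc⟩ := exists_countable_infinite_subset hinf
    exact hB (((hYI B (hBA.trans hA) hBc).2 d).subset fun b hb => ⟨hb, hd (hBA hb)⟩)
  · refine Or.inr ⟨S, hS, fun n A hA hAc => ?_⟩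
    rcases A.finite_or_infinite with hfin | hinf
    · exact hfin.bddAbove
    have htall : ∀ n, ∀ A ⊆ S n, A.Infinite → ∃ d, (A ∩ Iic d).Infinite := by
      intro n A hA hinf
      obtain ⟨B, hBA, hB, hBc⟩ := exists_countable_infinite_subset hinf
      by_contra! hcon
      exact hSI n B (hBA.trans hA) hBc hB
        ⟨hBc, fun d => (hcon d).subset (inter_subset_inter_left _ hBA)⟩
    have := hAc.to_subtype
    have := hinf.to_subtype
    obtain ⟨e⟩ := nonempty_equiv_of_countable (α := ℕ) (β := A)
    refine (bddAbove_range_of_injective hadd hD hS htall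
      (Subtype.val_injective.comp e.injective) fun i => hA (e i).2).mono ?_
    intro x hx
    exact ⟨e.symm ⟨x, hx⟩, by simp⟩

end DirectedSet

namespace DirectedSet

/-! ### The Tukey ordering -/

instance : Nonempty OmegaOne := nonempty_omegaOne

theorem mk_omegaOne : #OmegaOne = ℵ₁ := by
  simp [OmegaOne]

theorem countable_iff_mk_lt_aleph_one {α : Type u} {s : Set α} : s.Countable ↔ #s < ℵ₁ := by
  rw [← le_aleph0_iff_set_countable, ← Order.lt_succ_iff, succ_aleph0]

theorem countable_Iio_omegaOne (i : OmegaOne) : (Iio i).Countable := by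
  rw [countable_iff_mk_lt_aleph_one, ← mk_omegaOne]
  refine mk_Iio_lt i ?_
  rw [mk_omegaOne, ord_aleph, Ordinal.type_toType]

theorem countable_Iic_omegaOne (i : OmegaOne) : (Iic i).Countable := by
  rw [← Iio_insert]
  exact (countable_Iio_omegaOne i).insert i

theorem not_countable_univ_omegaOne : ¬ (Set.univ : Set OmegaOne).Countable := by
  rw [countable_iff_mk_lt_aleph_one, mk_univ, mk_omegaOne]
  exact lt_irrefl _

theorem bddAbove_of_countable_omegaOne {A : Set OmegaOne} (hA : A.Countable) : BddAbove A := by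
  by_contra hcon
  refine not_countable_univ_omegaOne ((hA.biUnion fun a _ => countable_Iic_omegaOne a).mono ?_)
  intro x _
  obtain ⟨a, ha, hxa⟩ := not_bddAbove_iff.1 hcon x
  exact mem_iUnion₂.2 ⟨a, ha, hxa.le⟩

theorem exists_embedding_omegaOne {D : Type u} (hD : #D ≤ ℵ₁) : Nonempty (D ↪ OmegaOne) := by
  rw [← lift_mk_le', mk_omegaOne]
  simpa using hD

theorem exists_embedding_of_not_countable {D : Type u} {Y : Set D} (hY : ¬ Y.Countable) :
    Nonempty (OmegaOne ↪ Y) := by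
  rw [← lift_mk_le', mk_omegaOne]
  rw [countable_iff_mk_lt_aleph_one, not_lt] at hY
  simpa using hY

variable {D : DirectedSet.{u}} {E : DirectedSet.{v}}

theorem TukeyLE.of_bddAbove (f : D → E) (h : ∀ X, BddAbove (f '' X) → BddAbove X) : TukeyLE D E :=
  ⟨f, fun X hX hfX => hX (h X hfX)⟩

universe w in
theorem TukeyLE.trans {F : DirectedSet.{w}} (h : TukeyLE D E) (h' : TukeyLE E F) :
    TukeyLE D F := by
  obtain ⟨f, hf⟩ := h
  obtain ⟨g, hg⟩ := h'
  refine ⟨g ∘ f, fun X hX => ?_⟩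
  rw [image_comp]
  exact hg _ (hf X hX)

theorem unit_tukeyLE : TukeyLE (⟨Unit⟩ : DirectedSet.{0}) D :=
  .of_bddAbove (fun _ => Classical.arbitrary D) fun _ _ => ⟨(), fun _ _ => le_rfl⟩

theorem tukeyLE_unit (h : BddAbove (Set.univ : Set D)) : TukeyLE D (⟨Unit⟩ : DirectedSet.{0}) :=
  .of_bddAbove (fun _ => ()) fun _ _ => h.mono (subset_univ _)

theorem nat_tukeyLE {A : Set D} (hA : A.Countable) (hunb : ¬ BddAbove A) :
    TukeyLE (⟨ℕ⟩ : DirectedSet.{0}) D := by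
  have hne : A.Nonempty := nonempty_iff_ne_empty.2 fun h => hunb (h ▸ bddAbove_empty)
  obtain ⟨c, rfl⟩ := hA.exists_eq_range hne
  choose f hf using fun n : ℕ => ((finite_Iic n).image c).bddAbove
  refine .of_bddAbove f fun X ⟨d, hd⟩ => ?_
  by_contra hX
  refine hunb ⟨d, ?_⟩
  rintro _ ⟨i, rfl⟩
  obtain ⟨n, hn, hin⟩ := not_bddAbove_iff.1 hX i
  exact (hf n ⟨i, le_of_lt hin, rfl⟩).trans (hd ⟨n, hn, rfl⟩)

theorem tukeyLE_nat {C : Set D} (hC : C.Countable) (hcof : ∀ d, ∃ c ∈ C, d ≤ c) :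
    TukeyLE D (⟨ℕ⟩ : DirectedSet.{0}) := by
  have hne : C.Nonempty := (hcof (Classical.arbitrary D)).imp fun _ h => h.1
  obtain ⟨c, rfl⟩ := hC.exists_eq_range hne
  simp only [exists_range_iff] at hcof
  choose f hf using hcof
  refine .of_bddAbove (E := ⟨ℕ⟩) f fun X ⟨N, hN⟩ => ?_
  obtain ⟨b, hb⟩ := ((finite_Iic (N : ℕ)).image c).bddAbove
  exact ⟨b, fun d hd => (hf d).trans (hb ⟨f d, hN ⟨d, hd, rfl⟩, rfl⟩)⟩

/-- Enumerate `D` by countable ordinals and let `y α` lie below no element of index less than `α`;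
then `y α ≤ d` forces `α ≤ e d`. -/
theorem omegaOne_tukeyLE (hD : #D ≤ ℵ₁)
    (h : ∀ C : Set D, C.Countable → ∃ d, ∀ c ∈ C, ¬ d ≤ c) :
    TukeyLE (⟨OmegaOne⟩ : DirectedSet.{0}) D := by
  obtain ⟨e⟩ := exists_embedding_omegaOne hD
  choose y hy using fun α => h (e ⁻¹' Iio α) ((countable_Iio_omegaOne α).preimage e.injective)
  refine .of_bddAbove (D := ⟨OmegaOne⟩) y fun X ⟨d, hd⟩ => ⟨e d, fun α hα => ?_⟩
  by_contra hcon
  exact hy α d (not_le.1 hcon) (hd ⟨α, hα, rfl⟩)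

/-- Any injection into `ω₁` works, since preimages of bounded sets are countable. -/
theorem tukeyLE_omegaOne (hD : #D ≤ ℵ₁) (h : ∀ A : Set D, A.Countable → BddAbove A) :
    TukeyLE D (⟨OmegaOne⟩ : DirectedSet.{0}) := by
  obtain ⟨e⟩ := exists_embedding_omegaOne hD
  refine .of_bddAbove (E := ⟨OmegaOne⟩) e fun X ⟨α, hα⟩ =>
    h X (((countable_Iic_omegaOne α).preimage e.injective).mono fun d hd => hα ⟨d, hd, rfl⟩)

theorem tukeyLE_nat_prod_omegaOne (hD : #D ≤ ℵ₁) {S : ℕ → Set D} (hS : ⋃ n, S n = Set.univ)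
    (h : ∀ n, ∀ A ⊆ S n, A.Countable → BddAbove A) :
    TukeyLE D (⟨ℕ × OmegaOne⟩ : DirectedSet.{0}) := by
  obtain ⟨e⟩ := exists_embedding_omegaOne hD
  choose n hn using fun d => mem_iUnion.1 (hS ▸ mem_univ d)
  refine .of_bddAbove (E := ⟨ℕ × OmegaOne⟩) (fun d => (n d, e d)) fun X ⟨⟨N, α⟩, hN⟩ => ?_
  have : BddAbove (⋃ i ∈ Iic N, S i ∩ e ⁻¹' Iic α) :=
    ((finite_Iic N).bddAbove_biUnion).2 fun i _ => h i _ inter_subset_left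
      (((countable_Iic_omegaOne α).preimage e.injective).mono inter_subset_right)
  refine this.mono fun d hd => ?_
  have hd' : (n d, e d) ≤ (N, α) := hN ⟨d, hd, rfl⟩
  exact mem_iUnion₂.2 ⟨n d, hd'.1, hn d, hd'.2⟩

theorem nat_prod_omegaOne_tukeyLE (h : TukeyLE (⟨ℕ⟩ : DirectedSet.{0}) D)
    (h' : TukeyLE (⟨OmegaOne⟩ : DirectedSet.{0}) D) :
    TukeyLE (⟨ℕ × OmegaOne⟩ : DirectedSet.{0}) D := by
  obtain ⟨f, hf⟩ := h
  obtain ⟨g, hg⟩ := h'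
  choose b hb using fun x : ℕ × OmegaOne => exists_ge_ge (f x.1) (g x.2)
  refine .of_bddAbove (D := ⟨ℕ × OmegaOne⟩) b fun X ⟨d, hd⟩ => ?_
  have h1 : BddAbove (Prod.fst '' X) := by
    by_contra hcon
    refine hf _ hcon ⟨d, ?_⟩
    rintro _ ⟨_, ⟨x, hx, rfl⟩, rfl⟩
    exact (hb x).1.trans (hd ⟨x, hx, rfl⟩)
  have h2 : BddAbove (Prod.snd '' X) := by
    by_contra hcon
    refine hg _ hcon ⟨d, ?_⟩
    rintro _ ⟨_, ⟨x, hx, rfl⟩, rfl⟩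
    exact (hb x).2.trans (hd ⟨x, hx, rfl⟩)
  exact bddAbove_prod.2 ⟨h1, h2⟩

theorem tukeyLE_finset_omegaOne (hD : #D ≤ ℵ₁) :
    TukeyLE D (⟨Finset OmegaOne⟩ : DirectedSet.{0}) := by
  obtain ⟨e⟩ := exists_embedding_omegaOne hD
  refine .of_bddAbove (E := ⟨Finset OmegaOne⟩) (fun d => {e d}) fun X ⟨s, hs⟩ => ?_
  refine Finite.bddAbove ((s.finite_toSet.preimage e.injective.injOn).subset fun d hd => ?_)
  exact Finset.singleton_subset_iff.1 (hs ⟨d, hd, rfl⟩)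

/-- Send a finite set to an upper bound of its copy in `Y`. A family with bounded image has its
union copied below one `d`, so the union is finite. -/
theorem finset_omegaOne_tukeyLE {Y : Set D} (hY : ¬ Y.Countable)
    (h : ∀ A ⊆ Y, A.Infinite → ¬ BddAbove A) :
    TukeyLE (⟨Finset OmegaOne⟩ : DirectedSet.{0}) D := by
  obtain ⟨e⟩ := exists_embedding_of_not_countable hY
  let g : OmegaOne → D := fun i => e i
  have hg : Function.Injective g := Subtype.val_injective.comp e.injective
  choose b hb using fun s : Finset OmegaOne => (s.finite_toSet.image g).bddAbove
  refine .of_bddAbove (D := ⟨Finset OmegaOne⟩) b fun X ⟨d, hd⟩ => ?_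
  have hfin : {i | ∃ s ∈ X, i ∈ s}.Finite := by
    by_contra hinf
    refine h (g '' {i | ∃ s ∈ X, i ∈ s}) ?_ (Infinite.image hg.injOn hinf) ⟨d, ?_⟩
    · rintro _ ⟨i, -, rfl⟩; exact (e i).2
    · rintro _ ⟨i, ⟨s, hs, his⟩, rfl⟩
      exact (hb s ⟨i, his, rfl⟩).trans (hd ⟨s, hs, rfl⟩)
  exact ⟨hfin.toFinset, fun s hs i hi => hfin.mem_toFinset.2 ⟨s, hs, hi⟩⟩

/-! ### The five types are different -/

theorem not_tukeyLE_unit (h : ¬ BddAbove (Set.univ : Set D)) :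
    ¬ TukeyLE D (⟨Unit⟩ : DirectedSet.{0}) :=
  fun ⟨_, hf⟩ => hf _ h ⟨(), fun _ _ => le_rfl⟩

theorem not_bddAbove_univ_omegaOne : ¬ BddAbove (Set.univ : Set OmegaOne) := fun ⟨i, hi⟩ =>
  not_countable_univ_omegaOne ((countable_Iic_omegaOne i).mono hi)

theorem not_omegaOne_tukeyLE_nat :
    ¬ TukeyLE (⟨OmegaOne⟩ : DirectedSet.{0}) (⟨ℕ⟩ : DirectedSet.{0}) := by
  rintro ⟨f, hf⟩
  change OmegaOne → ℕ at f
  refine not_countable_univ_omegaOne ((countable_iUnion (t := fun n => f ⁻¹' {n}) fun n => ?_).mono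
    fun i _ => mem_iUnion.2 ⟨f i, rfl⟩)
  have : BddAbove (f ⁻¹' {n}) := by
    by_contra hcon
    exact hf _ hcon (bddAbove_singleton.mono (image_preimage_subset f {n}))
  obtain ⟨i, hi⟩ := this
  exact (countable_Iic_omegaOne i).mono hi

theorem not_nat_tukeyLE_omegaOne :
    ¬ TukeyLE (⟨ℕ⟩ : DirectedSet.{0}) (⟨OmegaOne⟩ : DirectedSet.{0}) := by
  rintro ⟨f, hf⟩
  exact hf Set.univ (not_bddAbove_univ (α := ℕ))
    (bddAbove_of_countable_omegaOne (countable_univ.image f))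

/-- Infinitely many singletons are unbounded, but uncountably many of them cannot be split into
countably many finite classes by the first coordinate. On a countably infinite part of a class, the
second coordinates are bounded. -/
theorem not_finset_tukeyLE_nat_prod_omegaOne :
    ¬ TukeyLE (⟨Finset OmegaOne⟩ : DirectedSet.{0}) (⟨ℕ × OmegaOne⟩ : DirectedSet.{0}) := by
  rintro ⟨f, hf⟩
  change Finset OmegaOne → ℕ × OmegaOne at f
  let g : OmegaOne → ℕ := fun i => (f {i}).1
  refine not_countable_univ_omegaOne ((countable_iUnion (t := fun n => g ⁻¹' {n}) fun n => ?_).mono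
    fun i _ => mem_iUnion.2 ⟨g i, rfl⟩)
  refine Finite.countable ?_
  by_contra hinf
  obtain ⟨B, hB, hBinf, hBc⟩ := exists_countable_infinite_subset hinf
  refine hf (singleton '' B) ?_ ?_
  · rintro ⟨s, hs⟩
    exact hBinf (s.finite_toSet.subset fun i hi => Finset.singleton_subset_iff.1 (hs ⟨i, hi, rfl⟩))
  · obtain ⟨α, hα⟩ := bddAbove_of_countable_omegaOne (hBc.image fun i => (f {i}).2)
    refine ⟨(n, α), ?_⟩
    rintro _ ⟨_, ⟨i, hi, rfl⟩, rfl⟩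
    exact ⟨(hB hi : g i = n).le, hα ⟨i, hi, rfl⟩⟩

theorem nat_tukeyLE_nat_prod_omegaOne :
    TukeyLE (⟨ℕ⟩ : DirectedSet.{0}) (⟨ℕ × OmegaOne⟩ : DirectedSet.{0}) :=
  .of_bddAbove (D := ⟨ℕ⟩) (E := ⟨ℕ × OmegaOne⟩) (fun n => (n, Classical.arbitrary OmegaOne))
    fun _ ⟨b, hb⟩ => ⟨b.1, fun n hn => (hb ⟨n, hn, rfl⟩).1⟩

theorem omegaOne_tukeyLE_nat_prod_omegaOne :
    TukeyLE (⟨OmegaOne⟩ : DirectedSet.{0}) (⟨ℕ × OmegaOne⟩ : DirectedSet.{0}) :=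
  .of_bddAbove (D := ⟨OmegaOne⟩) (E := ⟨ℕ × OmegaOne⟩) (fun i => (0, i))
    fun _ ⟨b, hb⟩ => ⟨b.2, fun n hn => (hb ⟨n, hn, rfl⟩).2⟩

theorem mk_basicType_le (i : Fin 5) : #(basicType i) ≤ ℵ₁ := by
  have h0 : ℵ₀ ≤ ℵ₁ := aleph0_le_aleph 1
  have hinf : Infinite OmegaOne := by
    rw [infinite_iff, mk_omegaOne]; exact h0
  fin_cases i
  · change #Unit ≤ ℵ₁
    exact (mk_le_aleph0 (α := Unit)).trans h0
  · change #ℕ ≤ ℵ₁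
    exact (mk_le_aleph0 (α := ℕ)).trans h0
  · exact mk_omegaOne.le
  · change #(ℕ × OmegaOne) ≤ ℵ₁
    rw [mk_prod, mk_omegaOne]
    simp
  · change #(Finset OmegaOne) ≤ ℵ₁
    rw [mk_finset_of_infinite, mk_omegaOne]

theorem not_tukeyEquiv_basicType {i j : Fin 5} (hij : i ≠ j) :
    ¬ TukeyEquiv (basicType i) (basicType j) := by
  wlog hlt : i < j generalizing i j
  · exact fun h => this hij.symm (lt_of_le_of_ne (not_lt.1 hlt) hij.symm) ⟨h.2, h.1⟩
  -- For `i < j` it is always the reduction of the later type to the earlier one that fails.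
  rintro ⟨-, h⟩
  have hN : ¬ TukeyLE (⟨ℕ⟩ : DirectedSet.{0}) (⟨Unit⟩ : DirectedSet.{0}) :=
    not_tukeyLE_unit (D := ⟨ℕ⟩) not_bddAbove_univ
  have hO : ¬ TukeyLE (⟨OmegaOne⟩ : DirectedSet.{0}) (⟨Unit⟩ : DirectedSet.{0}) :=
    not_tukeyLE_unit (D := ⟨OmegaOne⟩) not_bddAbove_univ_omegaOne
  have hPF : TukeyLE (⟨ℕ × OmegaOne⟩ : DirectedSet.{0}) (⟨Finset OmegaOne⟩ : DirectedSet.{0}) :=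
    tukeyLE_finset_omegaOne (mk_basicType_le 3)
  have hNP := nat_tukeyLE_nat_prod_omegaOne
  have hOP := omegaOne_tukeyLE_nat_prod_omegaOne
  fin_cases i <;> fin_cases j <;> first | exact absurd hlt (by decide) | skip
  · exact hN h
  · exact hO h
  · exact hN (hNP.trans h)
  · exact hN ((hNP.trans hPF).trans h)
  · exact not_omegaOne_tukeyLE_nat h
  · exact not_omegaOne_tukeyLE_nat (hOP.trans h)
  · exact not_omegaOne_tukeyLE_nat ((hOP.trans hPF).trans h)
  · exact not_nat_tukeyLE_omegaOne (hNP.trans h)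
  · exact not_nat_tukeyLE_omegaOne ((hNP.trans hPF).trans h)
  · exact not_finset_tukeyLE_nat_prod_omegaOne h

/-! ### Classification -/

theorem exists_tukeyEquiv_basicType (hPID : PIdealDichotomy.{u}) (hadd : ℵ₁ < addMeager)
    (hD : #D ≤ ℵ₁) : ∃ i, TukeyEquiv D (basicType i) := by
  rcases exists_uncountable_or_cover hPID hadd hD with ⟨Y, hY, hYu⟩ | ⟨S, hS, hSb⟩
  · exact ⟨4, tukeyLE_finset_omegaOne hD, finset_omegaOne_tukeyLE hY hYu⟩
  by_cases hb : ∀ A : Set D, A.Countable → BddAbove A <;>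
    by_cases hc : ∀ C : Set D, C.Countable → ∃ d, ∀ c ∈ C, ¬ d ≤ c
  · exact ⟨2, tukeyLE_omegaOne hD hb, omegaOne_tukeyLE hD hc⟩
  · push Not at hc
    obtain ⟨C, hC, hcof⟩ := hc
    obtain ⟨b, hb⟩ := hb C hC
    refine ⟨0, tukeyLE_unit ⟨b, fun d _ => ?_⟩, unit_tukeyLE⟩
    obtain ⟨c, hc, hdc⟩ := hcof d
    exact hdc.trans (hb hc)
  · push Not at hb
    obtain ⟨A, hA, hunb⟩ := hb
    exact ⟨3, tukeyLE_nat_prod_omegaOne hD hS hSb,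
      nat_prod_omegaOne_tukeyLE (nat_tukeyLE hA hunb) (omegaOne_tukeyLE hD hc)⟩
  · push Not at hb hc
    obtain ⟨A, hA, hunb⟩ := hb
    obtain ⟨C, hC, hcof⟩ := hc
    exact ⟨1, tukeyLE_nat hC hcof, nat_tukeyLE hA hunb⟩

end DirectedSet

theorem mainTheorem8 (hPID : PIdealDichotomy.{u}) (hadd : ℵ₁ < addMeager) :
    (∀ i, #(DirectedSet.basicType i) ≤ ℵ₁) ∧
    (∀ i j, i ≠ j →
      ¬ DirectedSet.TukeyEquiv (DirectedSet.basicType i) (DirectedSet.basicType j)) ∧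
    (∀ D : DirectedSet.{u}, #D ≤ ℵ₁ →
      ∃ i, DirectedSet.TukeyEquiv D (DirectedSet.basicType i)) :=
  ⟨DirectedSet.mk_basicType_le, fun _ _ => DirectedSet.not_tukeyEquiv_basicType,
    fun _ => DirectedSet.exists_tukeyEquiv_basicType hPID hadd⟩
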